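/- Let $p$ be an odd prime and let $\mathcal T$ be the $p$-adic rooted tree, whose vertices are the finite words over $\{1,\dots,p\}$. Let $a\in\mathrm{Aut}(\mathcal T)$ be the rooted automorphism permuting the first letter by the cycle $(1\,2\cdots p)$, and let $\psi$ denote the isomorphism from the stabiliser of the first level of $\mathcal T$ to $\mathrm{Aut}(\mathcal T)\times\overset{p}{\cdots}\times\mathrm{Aut}(\mathcal T)$ given by restriction to the subtrees rooted at the first level. For each $j\in\{1,\dots,p\}$ let $\mathbf E^{(j)}=(\mathbf e^{(j)}_1,\dots,\mathbf e^{(j)}_{r_j})$ be a possibly empty tuple of linearly independent vectors $\mathbf e^{(j)}_i=(e^{(j)}_{i,1},\dots,e^{(j)}_{i,p-1})\in\mathbb F_p^{\,p-1}$, with $r_j\neq 0$ for at least one $j$. The associated multi-EGS group is $G=\langle a,\ b^{(j)}_i \mid 1\le j\le p,\ 1\le i\le r_j\rangle\le\mathrm{Aut}(\mathcal T)$, where the $b^{(j)}_i$ fix the first level and are defined recursively by $$\psi(b^{(j)}_i)=\big(a^{e^{(j)}_{i,j}},\dots,a^{e^{(j)}_{i,p-1}},\,b^{(j)}_i,\,a^{e^{(j)}_{i,1}},\dots,a^{e^{(j)}_{i,j-1}}\big).$$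 A GGS-group is a group $\langle a,b\rangle$ with $\psi(b)=(a^{e_1},\dots,a^{e_{p-1}},b)$ for some non-zero $(e_1,\dots,e_{p-1})\in\mathbb F_p^{\,p-1}$. Let $r$ be the dimension of the $\mathbb F_p$-vector space spanned by all the vectors $\mathbf e^{(j)}_i$, and let $\mathrm{St}_G(k)$ be the subgroup of the elements of $G$ that fix every vertex of level $k$. The group $G$ is *self-similar* if for every vertex $u$ and every $g\in G$ fixing $u$, the restriction of $g$ to the subtree rooted at $u$ (identified with $\mathcal T$) lies in $G$. It is *regular branch over* a subgroup $1\neq K\le G$ if $G$ is transitive on every level of $\mathcal T$ and self-similar, $|G:K|<\infty$, and $K\times\overset{p}{\cdots}\times K\subseteq\psi(\mathrm{St}_K(1))$. It is *periodic* if all its elements have finite order. A finite group $\Gamma$ *admits a ramification structure* if there are two tuples $T_1,T_2$ of non-trivial elements of $\Gamma$, of the same length, such that the entries of each tuple generate $\Gamma$ and have product $1$ in the given order, and $\Sigma(T_1)\cap\Sigma(T_2)=\{1\}$, where $\Sigma(T)$ is the union of all conjugates of the cyclic subgroups generated by the entries of $T$. **Theorem.** Suppose that $G$ is a multi-EGS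 group that is not a GGS-group. Then the finite group $G/\mathrm{St}_G(k)$ admits a ramification structure (i) for all $k\ge r+1$, if $G$ is regular branch over its derived subgroup $G'$; (ii) for all $k\ge 4$, if $G$ is periodic and not regular branch over $G'$; (iii) for all $k\ge 3$, if $G$ is non-periodic and not regular branch over $G'$. -/

import Mathlib

namespace MultiEGS

/-- The vertices of the `p`-adic rooted tree: finite words over the alphabet `{1, …, p}`. Letters are
written as residues modulo `p`, the letter `p` being the residue `0`. -/
abbrev Vertex (p : ℕ) : Type := List (ZMod p)

/-- `Aut(𝒯)`: the permutations of the vertices that preserve the levels and the prefix relation.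
(They act from the left here; the subgroups of `Aut(𝒯)` do not depend on this convention.) -/
def treeAut (p : ℕ) : Subgroup (Equiv.Perm (Vertex p)) where
  carrier := {f | (∀ u, (f u).length = u.length) ∧ ∀ u v, u <+: v → f u <+: f v}
  one_mem' := ⟨fun _ => rfl, fun _ _ h => h⟩
  mul_mem' := by
    rintro f g ⟨hf1, hf2⟩ ⟨hg1, hg2⟩
    exact ⟨fun u => (hf1 _).trans (hg1 u), fun u v h => hf2 _ _ (hg2 _ _ h)⟩
  inv_mem' := by
    rintro f ⟨hf1, hf2⟩
    have happ : ∀ u, f (f⁻¹ u) = u := f.apply_symm_apply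
    have hl : ∀ u, (f⁻¹ u).length = u.length := fun u => by
      conv_rhs => rw [← happ u]
      exact (hf1 _).symm
    refine ⟨hl, fun u v h => ?_⟩
    have h2 : f ((f⁻¹ v).take u.length) <+: v := by
      conv_rhs => rw [← happ v]
      exact hf2 _ _ (List.take_prefix _ _)
    have h3 : (f ((f⁻¹ v).take u.length)).length = u.length := by
      rw [hf1, List.length_take, hl]
      exact min_eq_left h.length_le
    have h4 : f ((f⁻¹ v).take u.length) = u :=
      (List.prefix_of_prefix_length_le h2 h h3.le).eq_of_length h3
    have h5 : f⁻¹ u = (f⁻¹ v).take u.length := by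
      rw [Equiv.Perm.inv_eq_iff_eq, h4]
    rw [h5]
    exact List.take_prefix _ _

/-- The group `Aut(𝒯)` as a type. -/
abbrev TreeAut (p : ℕ) : Type := treeAut p

variable {p : ℕ}

/-- `St_G(n)`, the subgroup of those elements of `G` that fix every vertex of level `n`. -/
def levelStab (G : Subgroup (TreeAut p)) (n : ℕ) : Subgroup G where
  carrier := {g | ∀ w : Vertex p, w.length = n → g.1.1 w = w}
  one_mem' := fun _ _ => rfl
  mul_mem' := by
    intro f g hf hg w hw
    change f.1.1 (g.1.1 w) = w
    rw [hg w hw, hf w hw]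
  inv_mem' := by
    intro f hf w hw
    change (f.1.1)⁻¹ w = w
    rw [Equiv.Perm.inv_eq_iff_eq, hf w hw]

instance levelStab_normal (G : Subgroup (TreeAut p)) (n : ℕ) : (levelStab G n).Normal where
  conj_mem := by
    intro f hf g w hw
    change g.1.1 (f.1.1 ((g.1.1)⁻¹ w)) = w
    rw [hf _ (((inv_mem g.1.2).1 w).trans hw)]
    exact g.1.1.apply_symm_apply w

/-- The quotients `G / St_G(n)` are finite. -/
instance finite_quotient [NeZero p] (G : Subgroup (TreeAut p)) (n : ℕ) :
    Finite (G ⧸ levelStab G n) := by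
  have hfin : Finite {w : Vertex p // w.length = n} :=
    (List.finite_length_eq (ZMod p) n).to_subtype
  let act : G → ({w : Vertex p // w.length = n} → {w : Vertex p // w.length = n}) :=
    fun g w => ⟨g.1.1 w.1, (g.1.2.1 w.1).trans w.2⟩
  refine Finite.of_injective (fun q : G ⧸ levelStab G n => act q.out) ?_
  intro q q' h
  rw [← q.out_eq', ← q'.out_eq']
  refine Quotient.sound' (QuotientGroup.leftRel_apply.2 ?_)
  intro w hw
  have h1 : q.out.1.1 w = q'.out.1.1 w := congrArg Subtype.val (congrFun h ⟨w, hw⟩)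
  change (q.out.1.1)⁻¹ (q'.out.1.1 w) = w
  rw [Equiv.Perm.inv_eq_iff_eq, h1]

/-- `g ∈ St(1)` and `ψ(g) = (k_1, …, k_p)`. -/
def HasPsi (g : TreeAut p) (k : ZMod p → TreeAut p) : Prop :=
  ∀ (x : ZMod p) (w : Vertex p), g.1 (x :: w) = x :: (k x).1 w

/-- `G` acts transitively on every level of the tree. -/
def SphericallyTransitive (G : Subgroup (TreeAut p)) : Prop :=
  ∀ u v : Vertex p, u.length = v.length → ∃ g ∈ G, g.1 u = v

/-- `G` is self-similar: if `g ∈ G` fixes the vertex `u`, then the restriction of `g` to the subtree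
rooted at `u`, which is identified with the whole tree by deleting the prefix `u`, belongs to `G`.
(The components of `ψ_n(g)` are such restrictions, at the vertices `u` of level `n`.) -/
def SelfSimilar (G : Subgroup (TreeAut p)) : Prop :=
  ∀ g ∈ G, ∀ u : Vertex p, g.1 u = u → ∃ h ∈ G, ∀ w : Vertex p, g.1 (u ++ w) = u ++ h.1 w

/-- `G` is regular branch over its subgroup `K`. -/
structure RegularBranchOver (G K : Subgroup (TreeAut p)) : Prop where
  transitive : SphericallyTransitive G
  selfSimilar : SelfSimilar G
  le : K ≤ G
  ne_bot : K ≠ ⊥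
  /-- `K × ⋯ × K ⊆ ψ(St_K(1))` -/
  branch : ∀ k : ZMod p → TreeAut p, (∀ x, k x ∈ K) → ∃ g ∈ K, HasPsi g k
  finiteIndex : (K.subgroupOf G).FiniteIndex

/-- `x₁x₂⋯xₙ ↦ (x₁ + m)x₂⋯xₙ`. -/
def shift (m : ZMod p) : Vertex p → Vertex p
  | [] => []
  | x :: w => (x + m) :: w

/-- The rooted automorphism that adds `m` to the first letter. -/
def rooted (m : ZMod p) : TreeAut p :=
  ⟨{ toFun := shift m
     invFun := shift (-m)
     left_inv := by rintro (_ | ⟨x, w⟩) <;> simp [shift]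
     right_inv := by rintro (_ | ⟨x, w⟩) <;> simp [shift] },
   by
    constructor
    · rintro (_ | ⟨x, w⟩) <;> simp [shift]
    · rintro (_ | ⟨x, w⟩) (_ | ⟨y, v⟩) h <;> simp_all [shift]⟩

/-- The rooted automorphism `a` given by the cycle `(1 2 ⋯ p)`. -/
def a : TreeAut p := rooted 1

/-- `a ^ n` adds `n` to the first letter; so `a ^ m` for `m ∈ 𝔽_p` is `rooted m`. -/
theorem a_pow (n : ℕ) : (a : TreeAut p) ^ n = rooted (n : ZMod p) := by
  induction n with
  | zero =>
    apply Subtype.ext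
    ext1 w
    change w = shift _ w
    cases w <;> simp [shift]
  | succ n ih =>
    rw [pow_succ, ih]
    apply Subtype.ext
    ext1 w
    change shift _ (shift 1 w) = shift _ w
    cases w <;> simp [shift, add_comm, add_left_comm]

variable (p) in
/-- The vectors `(e_1, …, e_{p-1})` over `𝔽_p`; the indices `1, …, p - 1` are written as the
non-zero residues modulo `p`. -/
abbrev Vec : Type := {i : ZMod p // i ≠ 0} → ZMod p

/-- The map that fixes the first letter `x` and acts on the remaining word as itself if `x = c`, and
as `a ^ {e_i}` if `x = c + i` (cyclically) with `1 ≤ i ≤ p - 1`. -/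
def dirFun (c : ZMod p) (e : Vec p) : Vertex p → Vertex p
  | [] => []
  | x :: w => x :: (if h : x - c = 0 then dirFun c e w else shift (e ⟨x - c, h⟩) w)

theorem dirFun_neg (c : ZMod p) (e : Vec p) (w : Vertex p) :
    dirFun c (-e) (dirFun c e w) = w := by
  induction w with
  | nil => rfl
  | cons x w ih =>
    by_cases h : x - c = 0
    · simp [dirFun, h, ih]
    · simp only [dirFun, h, dite_false, Pi.neg_apply]
      cases w <;> simp [shift]

theorem shift_mem (m : ZMod p) : (∀ u : Vertex p, (shift m u).length = u.length) ∧
    ∀ u v : Vertex p, u <+: v → shift m u <+: shift m v :=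
  (rooted m).2

theorem dirFun_mem (c : ZMod p) (e : Vec p) :
    (∀ u : Vertex p, (dirFun c e u).length = u.length) ∧
      ∀ u v : Vertex p, u <+: v → dirFun c e u <+: dirFun c e v := by
  constructor
  · intro u
    induction u with
    | nil => rfl
    | cons x u ih =>
      by_cases h : x - c = 0
      · simp [dirFun, h, ih]
      · simp [dirFun, h, (shift_mem _).1]
  · intro u
    induction u with
    | nil => intro v _; simp [dirFun]
    | cons x u ih =>
      rintro (_ | ⟨y, v⟩) h
      · simp at h
      · obtain ⟨rfl, h'⟩ := List.cons_prefix_cons.1 h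
        by_cases hx : x - c = 0
        · simpa [dirFun, hx] using ih v h'
        · simpa [dirFun, hx] using (shift_mem _).2 _ _ h'

/-- The directed automorphism `b` with `ψ(b)` having the entry `b` in position `c` and, continuing
cyclically from there, the entries `a^{e_1}, …, a^{e_{p-1}}`. -/
def directed (c : ZMod p) (e : Vec p) : TreeAut p :=
  ⟨{ toFun := dirFun c e
     invFun := dirFun c (-e)
     left_inv := dirFun_neg c e
     right_inv := fun w => by simpa using dirFun_neg c (-e) w }, dirFun_mem c e⟩

/-- The generator `b^{(j)}` with defining vector `e`, for `j ∈ {1, …, p}`: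
`ψ(b) = (a^{e_j}, …, a^{e_{p-1}}, b, a^{e_1}, …, a^{e_{j-1}})`, directed along the path that repeats
the letter `p - j + 1`. -/
def b (j : ZMod p) (e : Vec p) : TreeAut p := directed (1 - j) e

/-- The GGS-group with defining vector `e`, `ψ(b) = (a^{e_1}, …, a^{e_{p-1}}, b)`. -/
def ggsGroup (e : Vec p) : Subgroup (TreeAut p) := Subgroup.closure {a, b 1 e}

variable (p) in
/-- The numerical datum `𝐄 = (𝐄^{(1)}, …, 𝐄^{(p)})` of a multi-EGS group; `𝐄^{(j)}` is a tuple of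
`r_j ≥ 0` linearly independent vectors (so `r_j ≤ p - 1`), and not all `r_j` are zero. The index
`j ∈ {1, …, p}` is written as a residue modulo `p`. -/
structure Datum where
  num : ZMod p → ℕ
  vec : (j : ZMod p) → Fin (num j) → Vec p
  linearIndependent : ∀ j, LinearIndependent (ZMod p) (vec j)
  exists_num_ne_zero : ∃ j, num j ≠ 0

/-- The multi-EGS group `G_𝐄`. -/
def Datum.group (E : Datum p) : Subgroup (TreeAut p) :=
  Subgroup.closure ({a} ∪ {g | ∃ (j : ZMod p) (i : Fin (E.num j)), g = b j (E.vec j i)})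

/-- The dimension of the space spanned by all the defining vectors. -/
noncomputable def Datum.dim (E : Datum p) : ℕ :=
  Module.finrank (ZMod p)
    (Submodule.span (ZMod p) {v : Vec p | ∃ (j : ZMod p) (i : Fin (E.num j)), v = E.vec j i})

section Ramification

variable {Γ : Type*} [Group Γ]

/-- A spherical system of generators: a tuple of non-trivial elements that generate the group and
whose product, in the given order, is trivial. -/
structure IsSphericalSystem {n : ℕ} (T : Fin n → Γ) : Prop where
  ne_one : ∀ i, T i ≠ 1
  generates : Subgroup.closure (Set.range T) = ⊤
  prod_eq_one : (List.ofFn T).prod = 1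

/-- `Σ(T)`, the union of all conjugates of the cyclic subgroups generated by the entries of `T`. -/
def sigmaSet {n : ℕ} (T : Fin n → Γ) : Set Γ :=
  {x | ∃ (g : Γ) (i : Fin n), ∃ h ∈ Subgroup.zpowers (T i), x = g⁻¹ * h * g}

variable (Γ) in
/-- The finite group `Γ` has an unmixed ramification structure of size `(n, n)` for some `n`. -/
def AdmitsRamificationStructure [Finite Γ] : Prop :=
  ∃ (n : ℕ) (T₁ T₂ : Fin n → Γ), IsSphericalSystem T₁ ∧ IsSphericalSystem T₂ ∧
    sigmaSet T₁ ∩ sigmaSet T₂ = {1}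

end Ramification

end MultiEGS

namespace MultiEGS

/-! ### Ramification structures in finite groups -/

section GroupTheory

variable {Γ : Type*} [Group Γ]

/-! Listing each generator next to its inverse makes the product condition automatic, so a
ramification structure only needs two generating sets whose cyclic subgroups have no non-trivial
conjugates in common. The sets used are `{a, b, …}` and `{ab, ab², …}`, with `b` running over the
directed generators.

For `k ≥ 3`, suppose that `x ^ m` is conjugate to `y ^ n` modulo `St(k)`, with `x` in the first set
and `y` in the second. As `x` has order `p`, the element `y ^ (pn)` lies in `St(k) ≤ St(3)`. Now `y
= ab` with `b` directed along the letter `c`, and the section of `y ^ p` at `c` is `a ^ ε * b`,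
where `ε` is the sum of the entries of the defining vector (`rooted_mul_directed_pow_prime_apply`).
Applying this again to `a ^ ε * b` if `ε ≠ 0` gives `y ^ n ∈ St(2)`
(`mem_levelFixer_two_of_zpow_mem`). Hence `x ^ m ∈ St(2)`; since `x` still has order `p` modulo
`St(2)`, `x ^ m = 1`.

The bounds on `k` leave only `k = 2` with `r = 1`. There the quotient is a non-cyclic `p`-group
generated by two elements `α, β` of order `p`, and `⟨α⟩, ⟨β⟩, ⟨αβ⟩, ⟨αβ²⟩` are already separated in
the abelianization because `p` is odd. -/

theorem exists_ofFn_eq {α : Type*} {n : ℕ} (l : List α) (h : l.length = n) :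
    ∃ T : Fin n → α, List.ofFn T = l := by
  subst h
  exact ⟨l.get, List.ofFn_get l⟩

theorem prod_flatMap_pair_inv (l : List Γ) : (l.flatMap fun x => [x, x⁻¹]).prod = 1 := by
  induction l with
  | nil => rfl
  | cons x l ih => simp [ih]

theorem length_flatMap_pair_inv (l : List Γ) :
    (l.flatMap fun x => [x, x⁻¹]).length = l.length * 2 := by
  induction l with
  | nil => rfl
  | cons x l ih => simp [ih, add_mul]

/-- A non-empty generating set without the identity yields a spherical system of generators whose
entries are the elements of the set and their inverses. -/
theorem exists_isSphericalSystem [Finite Γ] (S : Set Γ) (hS : S.Nonempty) (h1 : (1 : Γ) ∉ S)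
    (hgen : Subgroup.closure S = ⊤) :
    ∃ T : Fin (Nat.card Γ * 2) → Γ, IsSphericalSystem T ∧
      (∀ i, T i ∈ S ∨ (T i)⁻¹ ∈ S) := by
  classical
  have := Fintype.ofFinite Γ
  obtain ⟨s, hs⟩ := hS
  -- Listing all of `Γ`, with the elements outside `S` replaced by `s`, gives a length independent
  -- of `S`, as both tuples of a ramification structure must have the same length.
  let f : Γ → Γ := fun x => if x ∈ S then x else s
  have hf : ∀ x, f x ∈ S := fun x => by
    by_cases h : x ∈ S <;> simp [f, h, hs]
  obtain ⟨T, hT⟩ := exists_ofFn_eq (n := Nat.card Γ * 2)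
    (((Finset.univ : Finset Γ).toList.map f).flatMap fun x => [x, x⁻¹])
    (by rw [length_flatMap_pair_inv]; simp)
  have hmem : ∀ y, y ∈ Set.range T ↔ ∃ x, y = f x ∨ y = (f x)⁻¹ := fun y => by
    rw [← List.mem_ofFn', hT]
    simp
  have hTS : ∀ i, T i ∈ S ∨ (T i)⁻¹ ∈ S := fun i => by
    obtain ⟨x, h | h⟩ := (hmem (T i)).1 ⟨i, rfl⟩
    · exact Or.inl (h ▸ hf x)
    · right
      rw [h, inv_inv]
      exact hf x
  refine ⟨T, ⟨fun i hi => ?_, ?_, ?_⟩, hTS⟩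
  · rcases hTS i with h | h
    · exact h1 (hi ▸ h)
    · rw [hi, inv_one] at h
      exact h1 h
  · refine top_le_iff.1 (hgen ▸ Subgroup.closure_mono fun x hx => ?_)
    exact (hmem x).2 ⟨x, Or.inl (by simp [f, hx])⟩
  · rw [hT]
    exact prod_flatMap_pair_inv _

/-- Two generating sets such that no non-trivial power of an element of the first is conjugate to a
power of an element of the second yield a ramification structure. -/
theorem admitsRamificationStructure_of_generating_sets [Finite Γ] (S₁ S₂ : Set Γ)
    (hne₁ : S₁.Nonempty) (hne₂ : S₂.Nonempty) (h₁ : (1 : Γ) ∉ S₁) (h₂ : (1 : Γ) ∉ S₂)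
    (hgen₁ : Subgroup.closure S₁ = ⊤) (hgen₂ : Subgroup.closure S₂ = ⊤)
    (hdisj : ∀ x ∈ S₁, ∀ y ∈ S₂, ∀ (g : Γ) (m n : ℤ), g⁻¹ * x ^ m * g = y ^ n → x ^ m = 1) :
    AdmitsRamificationStructure Γ := by
  obtain ⟨T₁, hT₁, hS₁⟩ := exists_isSphericalSystem S₁ hne₁ h₁ hgen₁
  obtain ⟨T₂, hT₂, hS₂⟩ := exists_isSphericalSystem S₂ hne₂ h₂ hgen₂
  have key : ∀ (S : Set Γ) (t : Γ), (t ∈ S ∨ t⁻¹ ∈ S) → ∀ h ∈ Subgroup.zpowers t,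
      ∃ x ∈ S, ∃ m : ℤ, h = x ^ m := by
    rintro S t ht _ ⟨m, rfl⟩
    rcases ht with ht | ht
    · exact ⟨t, ht, m, rfl⟩
    · exact ⟨t⁻¹, ht, -m, by simp⟩
  have i₀ : Fin (Nat.card Γ * 2) := ⟨0, by have := Nat.card_pos (α := Γ); omega⟩
  refine ⟨_, T₁, T₂, hT₁, hT₂, Set.Subset.antisymm ?_ ?_⟩
  · rintro z ⟨⟨g, i, h, hh, rfl⟩, g', i', h', hh', hz⟩
    obtain ⟨x, hx, m, rfl⟩ := key S₁ _ (hS₁ i) h hh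
    obtain ⟨y, hy, n, rfl⟩ := key S₂ _ (hS₂ i') h' hh'
    have hc : (g * g'⁻¹)⁻¹ * x ^ m * (g * g'⁻¹) = y ^ n := by
      calc (g * g'⁻¹)⁻¹ * x ^ m * (g * g'⁻¹) = g' * (g⁻¹ * x ^ m * g) * g'⁻¹ := by group
        _ = y ^ n := by rw [hz]; group
    simp [hdisj x hx y hy _ m n hc]
  · rintro z rfl
    exact ⟨⟨1, i₀, 1, one_mem _, by simp⟩, ⟨1, i₀, 1, one_mem _, by simp⟩⟩

/-- The derived subgroup of a finite nilpotent group consists of non-generators. -/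
theorem eq_top_of_sup_commutator_eq_top [Finite Γ] [Group.IsNilpotent Γ] (H : Subgroup Γ)
    (h : H ⊔ commutator Γ = ⊤) : H = ⊤ := by
  rcases eq_top_or_exists_le_coatom H with hH | ⟨K, hK, hHK⟩
  · exact hH
  · exfalso
    have hn : K.Normal :=
      Subgroup.NormalizerCondition.normal_of_coatom _ Group.normalizerCondition_of_isNilpotent hK
    have hKt : K ⊔ commutator Γ = ⊤ := top_le_iff.1 (h ▸ sup_le_sup_right hHK _)
    have : Nontrivial (Γ ⧸ K) := QuotientGroup.nontrivial_iff.2 hK.1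
    -- The quotient by the normal maximal subgroup `K` is non-trivial and solvable, yet `hKt` makes
    -- it perfect.
    have hlt := Group.IsSolvable.commutator_lt_top_of_nontrivial (Γ ⧸ K)
    refine hlt.ne ?_
    have hm := congrArg (Subgroup.map (QuotientGroup.mk' K)) hKt
    rwa [Subgroup.map_sup, QuotientGroup.map_mk'_self, bot_sup_eq, commutator_def,
      Subgroup.map_commutator, Subgroup.map_top_of_surjective _ (QuotientGroup.mk'_surjective K),
      ← commutator_def] at hm

theorem zpow_eq_one_of_prime_dvd {p : ℕ} {x : Γ} (hx : x ^ p = 1) {m : ℤ} (hm : (p : ℤ) ∣ m) :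
    x ^ m = 1 := by
  obtain ⟨q, rfl⟩ := hm
  rw [zpow_mul, zpow_natCast, hx, one_zpow]

/-- By Bézout, `m` is invertible modulo `p`, so `x` is a power of `x ^ m`. -/
theorem mem_zpowers_of_zpow_mem {p : ℕ} [Fact p.Prime] {H : Subgroup Γ} {x : Γ} (hx : x ^ p = 1)
    {m : ℤ} (hm : ¬ (p : ℤ) ∣ m) (h : x ^ m ∈ H) : x ∈ H := by
  have hc : IsCoprime (p : ℤ) m :=
    (Nat.prime_iff_prime_int.1 Fact.out).coprime_iff_not_dvd.2 hm
  obtain ⟨u, v, huv⟩ := hc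
  have : x = (x ^ m) ^ v := by
    rw [← zpow_mul, mul_comm]
    conv_lhs => rw [← zpow_one x, ← huv, zpow_add, zpow_eq_one_of_prime_dvd hx (Dvd.intro_left u rfl),
      one_mul]
  rw [this]
  exact zpow_mem h v

theorem closure_mul_mul_sq (α β : Γ) :
    Subgroup.closure {α * β, α * β ^ 2} = Subgroup.closure {α, β} := by
  refine le_antisymm ((Subgroup.closure_le _).2 ?_) ((Subgroup.closure_le _).2 ?_)
  · have hα : α ∈ Subgroup.closure {α, β} := Subgroup.subset_closure (by simp)
    have hβ : β ∈ Subgroup.closure {α, β} := Subgroup.subset_closure (by simp)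
    rintro x (rfl | rfl)
    · exact mul_mem hα hβ
    · exact mul_mem hα (pow_mem hβ 2)
  · have h₁ : α * β ∈ Subgroup.closure {α * β, α * β ^ 2} := Subgroup.subset_closure (by simp)
    have h₂ : α * β ^ 2 ∈ Subgroup.closure {α * β, α * β ^ 2} := Subgroup.subset_closure (by simp)
    have hβ : β ∈ Subgroup.closure {α * β, α * β ^ 2} := by
      have := mul_mem (inv_mem h₁) h₂
      rwa [show (α * β)⁻¹ * (α * β ^ 2) = β by group] at this
    rintro x (rfl | rfl)
    · have := mul_mem h₁ (inv_mem hβ)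
      rwa [mul_inv_cancel_right] at this
    · exact hβ

/-! ### Finite `p`-groups with two generators of order `p` -/

section TwoGenerators

variable {p : ℕ} [Fact p.Prime] [Finite Γ]

/-- Otherwise `α` generates modulo the derived subgroup, hence generates `Γ`, which puts `β` in
`⟨α⟩`. -/
theorem not_mem_sup_commutator (hΓ : IsPGroup p Γ) {α β : Γ}
    (hgen : Subgroup.closure {α, β} = ⊤) (hβα : β ∉ Subgroup.zpowers α) :
    β ∉ Subgroup.zpowers α ⊔ commutator Γ := by
  intro h
  have : Group.IsNilpotent Γ := hΓ.isNilpotent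
  have htop : Subgroup.zpowers α ⊔ commutator Γ = ⊤ := by
    refine top_le_iff.1 (hgen ▸ (Subgroup.closure_le _).2 ?_)
    rintro x (rfl | rfl)
    · exact (le_sup_left : _ ≤ Subgroup.zpowers x ⊔ commutator Γ) (Subgroup.mem_zpowers x)
    · exact h
  rw [eq_top_of_sup_commutator_eq_top _ htop] at hβα
  exact hβα trivial

/-- Two generators of order `p` of a non-cyclic `p`-group are independent in the abelianization. -/
theorem dvd_and_dvd_of_abelianization_eq_one (hΓ : IsPGroup p Γ) {α β : Γ} (hα : α ^ p = 1)
    (hβ : β ^ p = 1) (hgen : Subgroup.closure {α, β} = ⊤) (hβα : β ∉ Subgroup.zpowers α)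
    (hαβ : α ∉ Subgroup.zpowers β) {s t : ℤ}
    (h : (Abelianization.of α) ^ s * (Abelianization.of β) ^ t = 1) :
    (p : ℤ) ∣ s ∧ (p : ℤ) ∣ t := by
  have hmem : α ^ s * β ^ t ∈ commutator Γ := by
    rw [← Abelianization.ker_of, MonoidHom.mem_ker, map_mul, map_zpow, map_zpow, h]
  constructor
  · by_contra hs
    refine not_mem_sup_commutator hΓ (Set.pair_comm α β ▸ hgen) hαβ
      (mem_zpowers_of_zpow_mem hα hs ?_)
    have : α ^ s = (α ^ s * β ^ t) * (β ^ t)⁻¹ := by group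
    rw [this]
    exact mul_mem (Subgroup.mem_sup_right hmem)
      (inv_mem (Subgroup.mem_sup_left (Subgroup.zpow_mem_zpowers β t)))
  · by_contra ht
    refine not_mem_sup_commutator hΓ hgen hβα (mem_zpowers_of_zpow_mem hβ ht ?_)
    have : β ^ t = (α ^ s)⁻¹ * (α ^ s * β ^ t) := by group
    rw [this]
    exact mul_mem (inv_mem (Subgroup.mem_sup_left (Subgroup.zpow_mem_zpowers α s)))
      (Subgroup.mem_sup_right hmem)

/-- For an odd prime `p`, a non-cyclic finite `p`-group generated by two elements of order `p`
admits a ramification structure. -/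
theorem admitsRamificationStructure_of_isPGroup (hp : p ≠ 2) (hΓ : IsPGroup p Γ) {α β : Γ}
    (hα : α ^ p = 1) (hβ : β ^ p = 1) (hgen : Subgroup.closure {α, β} = ⊤)
    (hβα : β ∉ Subgroup.zpowers α) (hαβ : α ∉ Subgroup.zpowers β) :
    AdmitsRamificationStructure Γ := by
  have hind : ∀ {s t : ℤ}, (Abelianization.of α) ^ s * (Abelianization.of β) ^ t = 1 →
      (p : ℤ) ∣ s ∧ (p : ℤ) ∣ t :=
    dvd_and_dvd_of_abelianization_eq_one hΓ hα hβ hgen hβα hαβ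
  have hprime : Prime (p : ℤ) := Nat.prime_iff_prime_int.1 Fact.out
  have h2 : ∀ n : ℤ, (p : ℤ) ∣ 2 * n → (p : ℤ) ∣ n := fun n hn => by
    refine (hprime.dvd_or_dvd hn).resolve_left fun h => hp ?_
    exact (Nat.prime_dvd_prime_iff_eq Fact.out Nat.prime_two).1 (by exact_mod_cast h)
  refine admitsRamificationStructure_of_generating_sets {α, β} {α * β, α * β ^ 2}
    ⟨α, by simp⟩ ⟨α * β, by simp⟩ ?_ ?_ hgen (by rw [closure_mul_mul_sq, hgen]) ?_
  · rintro (h | h)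
    · exact hαβ (h ▸ one_mem _)
    · exact hβα (h ▸ one_mem _)
  · rintro (h | h)
    · exact hαβ (eq_inv_of_mul_eq_one_left h.symm ▸ inv_mem (Subgroup.mem_zpowers β))
    · exact hαβ (eq_inv_of_mul_eq_one_left (Eq.symm h) ▸
        inv_mem (pow_mem (Subgroup.mem_zpowers β) 2))
  · intro x hx y hy g m n h
    have hab := congrArg Abelianization.of h
    rw [map_mul, map_mul, map_inv, mul_comm, mul_inv_cancel_left, map_zpow, map_zpow] at hab
    -- Treats `αβ` and `αβ²` together as `αβ^r` with `r` prime to `p`; only `r = 2` needs `p` odd.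
    obtain ⟨r, hr, hyr⟩ : ∃ r : ℤ, ((p : ℤ) ∣ r * n → (p : ℤ) ∣ n) ∧
        Abelianization.of y = Abelianization.of α * Abelianization.of β ^ r := by
      rcases hy with rfl | rfl
      · exact ⟨1, by simp, by simp⟩
      · exact ⟨2, h2 n, by simp⟩
    rw [hyr, mul_zpow, ← zpow_mul] at hab
    -- Independence of `α` and `β` modulo the derived subgroup allows comparing exponents; one of
    -- them forces `p ∣ n` or `p ∣ r * n`, and the other then gives `p ∣ m`.
    rcases hx with rfl | rfl
    · have := hind (s := n - m) (t := r * n) (by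
        rw [zpow_sub, mul_right_comm, ← hab, mul_inv_cancel])
      exact zpow_eq_one_of_prime_dvd hα
        ((dvd_sub_right (hr this.2)).1 this.1)
    · have := hind (s := n) (t := r * n - m) (by
        rw [zpow_sub, ← mul_assoc, ← hab, mul_inv_cancel])
      exact zpow_eq_one_of_prime_dvd hβ
        ((dvd_sub_right (this.1.mul_left r)).1 this.2)

end TwoGenerators

end GroupTheory
-- Rooted and directed automorphisms and their action on the first levels
section Tree

variable {p : ℕ}

theorem mul_apply (g h : TreeAut p) (w : Vertex p) : (g * h).1 w = g.1 (h.1 w) := rfl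

theorem inv_apply_eq_iff {g : TreeAut p} {w v : Vertex p} : (g⁻¹).1 w = v ↔ w = g.1 v :=
  Equiv.Perm.inv_eq_iff_eq

theorem treeAut_ext {g h : TreeAut p} (H : ∀ w, g.1 w = h.1 w) : g = h :=
  Subtype.ext (Equiv.ext H)

/-- The stabiliser of the `n`-th level in `Aut(𝒯)`. -/
def levelFixer (p n : ℕ) : Subgroup (TreeAut p) where
  carrier := {g | ∀ w : Vertex p, w.length = n → g.1 w = w}
  one_mem' := fun _ _ => rfl
  mul_mem' := fun {f g} hf hg w hw => by rw [mul_apply, hg w hw, hf w hw]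
  inv_mem' := fun {f} hf w hw => inv_apply_eq_iff.2 (hf w hw).symm

instance levelFixer_normal (n : ℕ) : (levelFixer p n).Normal where
  conj_mem := by
    intro f hf g w hw
    rw [mul_apply, mul_apply, hf _ (((g⁻¹).2.1 w).trans hw)]
    exact g.1.apply_symm_apply w

/-- A shorter word is a prefix of a padded word of length `n`, and prefixes and lengths are
preserved. -/
theorem levelFixer_antitone : Antitone (levelFixer p) := by
  intro m n hmn g hg w hw
  have h := hg (w ++ List.replicate (n - m) 0) (by simp [hw, hmn])
  have hpre : g.1 w <+: w ++ List.replicate (n - m) 0 := by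
    conv_rhs => rw [← h]
    exact g.2.2 _ _ (List.prefix_append _ _)
  exact (List.prefix_of_prefix_length_le hpre (List.prefix_append _ _)
    (g.2.1 w).le).eq_of_length (g.2.1 w)

theorem rooted_add (m n : ZMod p) : rooted (m + n) = rooted m * rooted n :=
  treeAut_ext fun w => by
    change shift _ w = shift _ (shift _ w)
    cases w <;> simp [shift, add_comm, add_left_comm]

theorem rooted_zero : rooted (0 : ZMod p) = 1 := by
  simpa using rooted_add (0 : ZMod p) 0

theorem dirFun_add (c : ZMod p) (e f : Vec p) (w : Vertex p) :
    dirFun c (e + f) w = dirFun c e (dirFun c f w) := by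
  induction w with
  | nil => rfl
  | cons x w ih =>
    by_cases h : x - c = 0
    · simp [dirFun, h, ih]
    · simp only [dirFun, h, dite_false, Pi.add_apply]
      cases w <;> simp [shift, add_comm, add_left_comm]

theorem directed_add (c : ZMod p) (e f : Vec p) :
    directed c (e + f) = directed c e * directed c f :=
  treeAut_ext (dirFun_add c e f)

theorem directed_zero (c : ZMod p) : directed c (0 : Vec p) = 1 := by
  simpa using directed_add c (0 : Vec p) 0

theorem directed_zpow (c : ZMod p) (e : Vec p) (n : ℤ) : directed c e ^ n = directed c (n • e) := by
  let φ : Multiplicative (Vec p) →* TreeAut p :=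
    { toFun := fun e => directed c e.toAdd
      map_one' := directed_zero c
      map_mul' := fun _ _ => directed_add c _ _ }
  exact (map_zpow φ (Multiplicative.ofAdd e) n).symm

theorem directed_pow (c : ZMod p) (e : Vec p) (n : ℕ) : directed c e ^ n = directed c (n • e) := by
  simpa using directed_zpow c e n

theorem a_pow_prime : (a : TreeAut p) ^ p = 1 := by
  rw [a_pow, ZMod.natCast_self, rooted_zero]

theorem directed_pow_prime (c : ZMod p) (e : Vec p) : directed c e ^ p = 1 := by
  rw [directed_pow, show p • e = 0 by ext i; simp, directed_zero]

/-- The extension by zero of a defining vector to all residues. -/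
def extendZero (e : Vec p) (z : ZMod p) : ZMod p := if h : z = 0 then 0 else e ⟨z, h⟩

theorem extendZero_zero (e : Vec p) : extendZero e 0 = 0 := by simp [extendZero]

theorem extendZero_smul (l : ZMod p) (e : Vec p) (z : ZMod p) :
    extendZero (l • e) z = l * extendZero e z := by
  by_cases h : z = 0 <;> simp [extendZero, h]

theorem rooted_apply_cons (m x : ZMod p) (w : Vertex p) :
    (rooted m).1 (x :: w) = (x + m) :: w := rfl

theorem directed_apply_self (c : ZMod p) (e : Vec p) (w : Vertex p) :
    (directed c e).1 (c :: w) = c :: (directed c e).1 w := by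
  change dirFun c e (c :: w) = c :: dirFun c e w
  simp [dirFun]

theorem directed_apply_of_ne (c : ZMod p) (e : Vec p) {x : ZMod p} (h : x ≠ c) (w : Vertex p) :
    (directed c e).1 (x :: w) = x :: (rooted (extendZero e (x - c))).1 w := by
  have h' : x - c ≠ 0 := sub_ne_zero.2 h
  change dirFun c e (x :: w) = x :: shift _ w
  simp [dirFun, h', extendZero]

/-- `g` permutes the first level by adding `m`. -/
def ShiftsFirstLevel (g : TreeAut p) (m : ZMod p) : Prop := ∀ x : ZMod p, g.1 [x] = [x + m]

theorem ShiftsFirstLevel.mul {g h : TreeAut p} {m n : ZMod p} (hg : ShiftsFirstLevel g m)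
    (hh : ShiftsFirstLevel h n) : ShiftsFirstLevel (g * h) (m + n) := fun x => by
  rw [mul_apply, hh, hg, add_assoc, add_comm n]

theorem ShiftsFirstLevel.inv {g : TreeAut p} {m : ZMod p} (hg : ShiftsFirstLevel g m) :
    ShiftsFirstLevel g⁻¹ (-m) := fun x => by
  rw [inv_apply_eq_iff, hg, neg_add_cancel_right]

theorem ShiftsFirstLevel.pow {g : TreeAut p} {m : ZMod p} (hg : ShiftsFirstLevel g m) (n : ℕ) :
    ShiftsFirstLevel (g ^ n) (n * m) := by
  induction n with
  | zero => intro x; simp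
  | succ n ih =>
    rw [pow_succ]
    convert ih.mul hg using 1
    push_cast
    ring

theorem ShiftsFirstLevel.zpow {g : TreeAut p} {m : ZMod p} (hg : ShiftsFirstLevel g m) (n : ℤ) :
    ShiftsFirstLevel (g ^ n) (n * m) := by
  rcases n.eq_nat_or_neg with ⟨k, rfl | rfl⟩
  · simpa using hg.pow k
  · simpa using (hg.pow k).inv

theorem ShiftsFirstLevel.mem_levelFixer_one_iff {g : TreeAut p} {m : ZMod p}
    (hg : ShiftsFirstLevel g m) : g ∈ levelFixer p 1 ↔ m = 0 := by
  constructor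
  · intro h
    have h0 := h [0] rfl
    rw [hg] at h0
    simpa using h0
  · rintro rfl w hw
    obtain ⟨x, rfl⟩ := List.length_eq_one_iff.1 hw
    rw [hg, add_zero]

theorem shiftsFirstLevel_rooted (m : ZMod p) : ShiftsFirstLevel (rooted m) m := fun _ => rfl

theorem shiftsFirstLevel_directed (c : ZMod p) (e : Vec p) :
    ShiftsFirstLevel (directed c e) 0 := fun x => by
  rw [add_zero]
  by_cases h : x = c
  · rw [h, directed_apply_self]; rfl
  · rw [directed_apply_of_ne c e h]; rfl

theorem directed_apply_pair (c : ZMod p) (e : Vec p) (x y : ZMod p) :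
    (directed c e).1 [x, y] = [x, y + extendZero e (x - c)] := by
  by_cases h : x = c
  · rw [h, directed_apply_self, shiftsFirstLevel_directed, sub_self, extendZero_zero]
  · rw [directed_apply_of_ne c e h, rooted_apply_cons]

/-- Taking sections at a fixed vertex is multiplicative. -/
theorem zpow_apply_cons {g h : TreeAut p} {c : ZMod p} (H : ∀ w, g.1 (c :: w) = c :: h.1 w)
    (n : ℤ) (w : Vertex p) : (g ^ n).1 (c :: w) = c :: (h ^ n).1 w := by
  have hnat : ∀ (k : ℕ) (w : Vertex p), (g ^ k).1 (c :: w) = c :: (h ^ k).1 w := by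
    intro k
    induction k with
    | zero => intro w; rfl
    | succ k ih => intro w; rw [pow_succ, pow_succ, mul_apply, mul_apply, H, ih]
  rcases n.eq_nat_or_neg with ⟨k, rfl | rfl⟩
  · simpa using hnat k w
  · rw [zpow_neg, zpow_neg, zpow_natCast, zpow_natCast, inv_apply_eq_iff, hnat]
    exact congrArg _ ((h ^ k).1.apply_symm_apply w).symm

/-! ### Powers of `a ^ m * b` -/

section Prime

variable [Fact p.Prime]

/-- The sum of the entries of a defining vector. -/
def total (e : Vec p) : ZMod p := ∑ z, extendZero e z

theorem intCast_mul_eq_zero {m : ZMod p} (hm : m ≠ 0) {n : ℤ} (h : (n : ZMod p) * m = 0) :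
    (p : ℤ) ∣ n :=
  (ZMod.intCast_zmod_eq_zero_iff_dvd n p).1 ((mul_eq_zero.1 h).resolve_right hm)

theorem exists_natCast_mul {m : ZMod p} (hm : m ≠ 0) (z : ZMod p) : ∃ j : ℕ, j * m = z :=
  ⟨(z * m⁻¹).val, by rw [ZMod.natCast_zmod_val, inv_mul_cancel_right₀ hm]⟩

theorem natCast_mul_ne_zero {m : ZMod p} (hm : m ≠ 0) {j : ℕ} (h0 : j ≠ 0) (hj : j < p) :
    (j : ZMod p) * m ≠ 0 := by
  refine mul_ne_zero (fun h => ?_) hm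
  exact Nat.not_dvd_of_pos_of_lt (Nat.pos_of_ne_zero h0) hj ((ZMod.natCast_eq_zero_iff j p).1 h)

theorem sum_range_extendZero (e : Vec p) {m : ZMod p} (hm : m ≠ 0) :
    ∑ i ∈ Finset.range p, extendZero e (i * m) = total e := by
  refine Finset.sum_bij (fun i _ => (i : ZMod p) * m) (fun _ _ => Finset.mem_univ _) ?_ ?_
    (fun _ _ => rfl)
  · intro i hi j hj h
    have h' := mul_right_cancel₀ hm h
    rwa [ZMod.natCast_eq_natCast_iff', Nat.mod_eq_of_lt (Finset.mem_range.1 hi),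
      Nat.mod_eq_of_lt (Finset.mem_range.1 hj)] at h'
  · intro z _
    refine ⟨(z * m⁻¹).val, Finset.mem_range.2 (ZMod.val_lt _), ?_⟩
    rw [ZMod.natCast_zmod_val, inv_mul_cancel_right₀ hm]

/-- Follows the orbit `c, c + m, c + 2m, …`: the visit to `c` contributes the section `b`, and each
later vertex `c + im` contributes the corresponding power of `a`. The bound on `j` keeps the orbit
from returning to `c` too early; the summand `i = 0` is zero by convention. -/
theorem rooted_mul_directed_pow_succ_apply (c : ZMod p) (e : Vec p) {m : ZMod p} (hm : m ≠ 0)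
    (j : ℕ) (hj : j < p) (w : Vertex p) :
    ((rooted m * directed c e) ^ (j + 1)).1 (c :: w) =
      (c + (j + 1 : ℕ) * m) ::
        (rooted (∑ i ∈ Finset.range (j + 1), extendZero e (i * m)) * directed c e).1 w := by
  induction j with
  | zero =>
    rw [zero_add, pow_one, mul_apply, directed_apply_self, rooted_apply_cons]
    simp [extendZero_zero, rooted_zero]
  | succ j ih =>
    have hne : c + (j + 1 : ℕ) * m ≠ c := fun h =>
      natCast_mul_ne_zero hm j.succ_ne_zero hj (by simpa using h)
    rw [pow_succ', mul_apply, ih (by omega), mul_apply, directed_apply_of_ne c e hne,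
      rooted_apply_cons, Finset.sum_range_succ _ (j + 1), add_comm (∑ i ∈ _, _), rooted_add,
      mul_assoc, mul_apply _ (_ * _), add_sub_cancel_left]
    congr 1
    push_cast
    ring

/-- The `p`-th power of `a ^ m * b` with `m ≠ 0` has at the vertex `c` the section `a ^ ε * b`,
where `ε` is the sum of the entries of the defining vector of `b`. -/
theorem rooted_mul_directed_pow_prime_apply (c : ZMod p) (e : Vec p) {m : ZMod p} (hm : m ≠ 0)
    (w : Vertex p) :
    ((rooted m * directed c e) ^ p).1 (c :: w) = c :: (rooted (total e) * directed c e).1 w := by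
  have hp : p - 1 + 1 = p := Nat.sub_add_cancel (Fact.out : p.Prime).one_le
  have h := rooted_mul_directed_pow_succ_apply c e hm (p - 1) (by omega) w
  rwa [hp, sum_range_extendZero e hm, ZMod.natCast_self, zero_mul, add_zero] at h

/-- The section at `c` decides everything: `x = a ^ m * b` is transitive on the first level and
commutes with its powers, so the sections of `x ^ (pn)` at all first-level vertices are conjugate.
-/
theorem rooted_mul_directed_mem_levelFixer_succ_iff (c : ZMod p) (e : Vec p) {m : ZMod p}
    (hm : m ≠ 0) (n : ℤ) (k : ℕ) :
    (rooted m * directed c e) ^ ((p : ℤ) * n) ∈ levelFixer p (k + 1) ↔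
      (rooted (total e) * directed c e) ^ n ∈ levelFixer p k := by
  set x := rooted m * directed c e with hx
  have happ : ∀ w, (x ^ ((p : ℤ) * n)).1 (c :: w) =
      c :: ((rooted (total e) * directed c e) ^ n).1 w := by
    rw [zpow_mul, zpow_natCast]
    exact zpow_apply_cons (rooted_mul_directed_pow_prime_apply c e hm) n
  constructor
  · intro h w hw
    have := h (c :: w) (by simp [hw])
    rw [happ] at this
    exact (List.cons.inj this).2
  · intro h w hw
    obtain ⟨y, v, rfl⟩ := List.exists_cons_of_length_eq_add_one hw
    obtain ⟨j, hj⟩ := exists_natCast_mul hm (y - c)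
    have hxm : ShiftsFirstLevel x m := by
      simpa using (shiftsFirstLevel_rooted m).mul (shiftsFirstLevel_directed c e)
    -- Carries the given word back to the subtree at `c` by a power of `x`.
    obtain ⟨u, hu⟩ : ∃ u, (x ^ j).1 (c :: u) = y :: v := by
      have hlen : ((x ^ j)⁻¹.1 (y :: v)).length = k + 1 := ((x ^ j)⁻¹.2.1 _).trans hw
      obtain ⟨z, u, hzu⟩ := List.exists_cons_of_length_eq_add_one hlen
      have hz := inv_apply_eq_iff.1 hzu
      have hpre : [z + j * m] <+: y :: v := by
        rw [hz, ← hxm.pow j z]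
        exact (x ^ j).2.2 _ _ (by simp)
      have hzy : z + j * m = y := (List.cons_prefix_cons.1 hpre).1
      have hzc : z = c := by
        rw [hj] at hzy
        linear_combination hzy
      exact ⟨u, by rw [hz, hzc]⟩
    have hul : u.length = k := by
      have := (x ^ j).2.1 (c :: u)
      rw [hu, hw] at this
      simpa using this.symm
    have hcomm : x ^ ((p : ℤ) * n) * x ^ j = x ^ j * x ^ ((p : ℤ) * n) :=
      ((Commute.refl x).pow_right j).zpow_left _
    rw [← hu, ← mul_apply, hcomm, mul_apply, happ, h u hul]

/-- A non-zero entry of `e` at `i` is visible on the second level, as a shift of the letters below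
`c + i`. -/
theorem dvd_of_directed_zpow_mem_levelFixer_two {c : ZMod p} {e : Vec p} (he : e ≠ 0) {n : ℤ}
    (h : directed c e ^ n ∈ levelFixer p 2) : (p : ℤ) ∣ n := by
  obtain ⟨⟨i, hi⟩, hei⟩ := Function.ne_iff.1 he
  rw [directed_zpow] at h
  have h1 := h [c + i, 0] rfl
  rw [directed_apply_pair] at h1
  refine intCast_mul_eq_zero hei ?_
  simpa [extendZero, hi] using h1

/-- If the `p`-th power of an element of `⟨ab⟩` fixes the third level, then the element itself fixes
the second level. -/
theorem mem_levelFixer_two_of_zpow_mem {c : ZMod p} {e : Vec p} (he : e ≠ 0) {n : ℤ}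
    (h : (rooted 1 * directed c e) ^ ((p : ℤ) * n) ∈ levelFixer p 3) :
    (rooted 1 * directed c e) ^ n ∈ levelFixer p 2 := by
  have key : ∀ {m : ZMod p}, m ≠ 0 → ∀ (n : ℤ) (k : ℕ), _ :=
    fun {m} hm n k => rooted_mul_directed_mem_levelFixer_succ_iff c e hm n k
  rw [key one_ne_zero] at h
  have hy : ShiftsFirstLevel (rooted (total e) * directed c e) (total e) := by
    simpa using (shiftsFirstLevel_rooted (total e)).mul (shiftsFirstLevel_directed c e)
  -- If `ε = 0`, the section is `b ^ n ∈ St(2)`, so `p ∣ n`; after cancelling one factor `p`, only a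
  -- power of `b` in `St(1)` is required, which is automatic.
  by_cases hε : total e = 0
  · have hn : (p : ℤ) ∣ n := by
      rw [hε, rooted_zero, one_mul] at h
      exact dvd_of_directed_zpow_mem_levelFixer_two he h
    obtain ⟨n, rfl⟩ := hn
    rw [key one_ne_zero, (hy.zpow n).mem_levelFixer_one_iff, hε, mul_zero]
  -- If `ε ≠ 0`, the first level gives `p ∣ n`; then `(ab) ^ n` and `(a ^ ε * b) ^ n` lie in `St(2)`
  -- under the same condition, as their sections at `c` agree.
  · have h1 := levelFixer_antitone one_le_two h
    obtain ⟨n, rfl⟩ := intCast_mul_eq_zero hε ((hy.zpow n).mem_levelFixer_one_iff.1 h1)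
    rw [key one_ne_zero]
    exact (key hε n 1).1 h

end Prime

end Tree
-- Congruence quotients of level at least three
section Quotients

variable {p : ℕ}

theorem mk_eq_one_iff {G : Subgroup (TreeAut p)} {k : ℕ} (g : G) :
    (g : G ⧸ levelStab G k) = 1 ↔ g.1 ∈ levelFixer p k :=
  QuotientGroup.eq_one_iff g

/-- The image in `G / St_G(k)` of a set of automorphisms. -/
def imageInQuotient (G : Subgroup (TreeAut p)) (k : ℕ) (X : Set (TreeAut p)) :
    Set (G ⧸ levelStab G k) :=
  QuotientGroup.mk' (levelStab G k) '' (Subtype.val ⁻¹' X)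

theorem closure_imageInQuotient (X : Set (TreeAut p)) (k : ℕ) :
    Subgroup.closure (imageInQuotient (Subgroup.closure X) k X) = ⊤ := by
  rw [imageInQuotient, ← MonoidHom.map_closure, Subgroup.closure_closure_coe_preimage,
    Subgroup.map_top_of_surjective _ (QuotientGroup.mk'_surjective _)]

/-- The generators of a multi-EGS group. -/
def Datum.generators (E : Datum p) : Set (TreeAut p) :=
  {a} ∪ {g | ∃ (j : ZMod p) (i : Fin (E.num j)), g = b j (E.vec j i)}

/-- The products `ab` and `ab²` of the generators of a multi-EGS group. -/
def Datum.products (E : Datum p) : Set (TreeAut p) :=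
  {g | ∃ (j : ZMod p) (i : Fin (E.num j)),
    g = a * b j (E.vec j i) ∨ g = a * b j (E.vec j i) ^ 2}

theorem Datum.a_mem (E : Datum p) : a ∈ E.group := Subgroup.subset_closure (Or.inl rfl)

theorem Datum.b_mem (E : Datum p) (j : ZMod p) (i : Fin (E.num j)) : b j (E.vec j i) ∈ E.group :=
  Subgroup.subset_closure (Or.inr ⟨j, i, rfl⟩)

theorem Datum.closure_products (E : Datum p) : Subgroup.closure E.products = E.group := by
  refine le_antisymm ((Subgroup.closure_le _).2 ?_) ?_
  · rintro _ ⟨j, i, rfl | rfl⟩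
    · exact mul_mem E.a_mem (E.b_mem j i)
    · exact mul_mem E.a_mem (pow_mem (E.b_mem j i) 2)
  · have hpair : ∀ (j : ZMod p) (i : Fin (E.num j)),
        Subgroup.closure {a, b j (E.vec j i)} ≤ Subgroup.closure E.products := fun j i => by
      rw [← closure_mul_mul_sq]
      refine Subgroup.closure_mono ?_
      rintro x (rfl | rfl)
      · exact ⟨j, i, Or.inl rfl⟩
      · exact ⟨j, i, Or.inr rfl⟩
    refine (Subgroup.closure_le _).2 ?_
    rintro _ (rfl | ⟨j, i, rfl⟩)
    -- Recovering `a` from the products requires at least one directed generator.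
    · obtain ⟨j, hj⟩ := E.exists_num_ne_zero
      exact hpair j ⟨0, Nat.pos_of_ne_zero hj⟩ (Subgroup.subset_closure (by simp))
    · exact hpair j i (Subgroup.subset_closure (by simp))

theorem Datum.pow_prime_of_mem_generators (E : Datum p) {x : TreeAut p} (hx : x ∈ E.generators) :
    x ^ p = 1 := by
  rcases hx with rfl | ⟨j, i, rfl⟩
  · exact a_pow_prime
  · exact directed_pow_prime _ _

variable [Fact p.Prime]

theorem Datum.vec_ne_zero (E : Datum p) (j : ZMod p) (i : Fin (E.num j)) : E.vec j i ≠ 0 :=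
  (E.linearIndependent j).ne_zero i

/-- The square of `b` is directed with vector `2e`, non-zero for odd `p`, so `ab` and `ab²` need no
separate treatment. -/
theorem Datum.exists_of_mem_products (hp : p ≠ 2) (E : Datum p) {y : TreeAut p}
    (hy : y ∈ E.products) : ∃ (c : ZMod p) (e : Vec p), e ≠ 0 ∧ y = rooted 1 * directed c e := by
  obtain ⟨j, i, rfl | rfl⟩ := hy
  · exact ⟨1 - j, E.vec j i, E.vec_ne_zero j i, rfl⟩
  · refine ⟨1 - j, 2 • E.vec j i, fun h => ?_, by rw [← directed_pow]; rfl⟩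
    have h2 : ((2 : ℕ) : ZMod p) ≠ 0 := fun h2 =>
      hp ((Nat.prime_dvd_prime_iff_eq Fact.out Nat.prime_two).1
        ((ZMod.natCast_eq_zero_iff 2 p).1 h2))
    rw [← Nat.cast_smul_eq_nsmul (ZMod p)] at h
    exact E.vec_ne_zero j i ((smul_eq_zero.1 h).resolve_left h2)

theorem shiftsFirstLevel_a_mul_directed (c : ZMod p) (e : Vec p) :
    ShiftsFirstLevel (rooted 1 * directed c e) 1 := by
  simpa using (shiftsFirstLevel_rooted (1 : ZMod p)).mul (shiftsFirstLevel_directed c e)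

theorem directed_not_mem_levelFixer {c : ZMod p} {e : Vec p} (he : e ≠ 0) {k : ℕ} (hk : 2 ≤ k) :
    directed c e ∉ levelFixer p k := fun h => by
  have h1 := dvd_of_directed_zpow_mem_levelFixer_two (n := 1) he
    (by simpa using levelFixer_antitone hk h)
  exact (Nat.prime_iff_prime_int.1 (Fact.out : p.Prime)).not_dvd_one h1

theorem not_mem_levelFixer_of_shiftsFirstLevel {g : TreeAut p} (hg : ShiftsFirstLevel g 1) {k : ℕ}
    (hk : 1 ≤ k) : g ∉ levelFixer p k := fun h =>
  one_ne_zero (hg.mem_levelFixer_one_iff.1 (levelFixer_antitone hk h))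

theorem Datum.dvd_of_mem_generators (E : Datum p) {x : TreeAut p} (hx : x ∈ E.generators) {m : ℤ}
    (h : x ^ m ∈ levelFixer p 2) : (p : ℤ) ∣ m := by
  rcases hx with rfl | ⟨j, i, rfl⟩
  · exact intCast_mul_eq_zero one_ne_zero
      (((shiftsFirstLevel_rooted (1 : ZMod p)).zpow m).mem_levelFixer_one_iff.1
        (levelFixer_antitone one_le_two h))
  · exact dvd_of_directed_zpow_mem_levelFixer_two (E.vec_ne_zero j i) h

theorem Datum.admitsRamificationStructure_of_three_le (hp : p ≠ 2) (E : Datum p) {k : ℕ}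
    (hk : 3 ≤ k) : AdmitsRamificationStructure (E.group ⧸ levelStab E.group k) := by
  obtain ⟨j₀, hj₀⟩ := E.exists_num_ne_zero
  let i₀ : Fin (E.num j₀) := ⟨0, Nat.pos_of_ne_zero hj₀⟩
  refine admitsRamificationStructure_of_generating_sets
    (imageInQuotient E.group k E.generators) (imageInQuotient E.group k E.products)
    ⟨_, ⟨a, E.a_mem⟩, Or.inl rfl, rfl⟩
    ⟨_, ⟨a * b j₀ (E.vec j₀ i₀), mul_mem E.a_mem (E.b_mem _ _)⟩, ⟨j₀, i₀, Or.inl rfl⟩, rfl⟩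
    ?_ ?_ (closure_imageInQuotient _ k) ?_ ?_
  · rintro ⟨g, hg, h1⟩
    have hg1 := (mk_eq_one_iff g).1 h1
    rcases hg with hg | ⟨j, i, hg⟩
    · rw [Set.mem_singleton_iff.1 hg] at hg1
      exact not_mem_levelFixer_of_shiftsFirstLevel (shiftsFirstLevel_rooted 1) (by omega) hg1
    · rw [hg] at hg1
      exact directed_not_mem_levelFixer (E.vec_ne_zero j i) (by omega) hg1
  · rintro ⟨g, hg, h1⟩
    have hg1 := (mk_eq_one_iff g).1 h1
    obtain ⟨c, e, -, hce⟩ := E.exists_of_mem_products hp hg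
    rw [hce] at hg1
    exact not_mem_levelFixer_of_shiftsFirstLevel (shiftsFirstLevel_a_mul_directed c e)
      (by omega) hg1
  · have h := closure_imageInQuotient E.products k
    rwa [E.closure_products] at h
  · rintro _ ⟨x, hx, rfl⟩ _ ⟨y, hy, rfl⟩ q m n h
    obtain ⟨g, rfl⟩ := QuotientGroup.mk'_surjective (levelStab E.group k) q
    obtain ⟨c, e, he, hce⟩ := E.exists_of_mem_products hp hy
    simp only [← map_zpow, ← map_inv, ← map_mul] at h ⊢
    have hxp : x ^ p = 1 := Subtype.ext (E.pow_prime_of_mem_generators hx)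
    -- Modulo `St(k)`, `y ^ n` is conjugate to a power of `x`, which has order `p`.
    have hyn : y.1 ^ ((p : ℤ) * n) ∈ levelFixer p k := by
      refine (mk_eq_one_iff (y ^ ((p : ℤ) * n))).1 ?_
      change QuotientGroup.mk' (levelStab E.group k) _ = 1
      rw [mul_comm, zpow_mul, map_zpow _ (y ^ n), ← h, ← map_zpow]
      have hconj : (g⁻¹ * x ^ m * g) ^ (p : ℤ) = 1 := by
        have := conj_zpow (i := (p : ℤ)) (a := g⁻¹) (b := x ^ m)
        rw [inv_inv] at this
        rw [this, ← zpow_mul, mul_comm, zpow_mul, zpow_natCast, hxp]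
        simp
      rw [hconj, map_one]
    rw [hce] at hyn
    have hyn2 := mem_levelFixer_two_of_zpow_mem he (levelFixer_antitone hk hyn)
    rw [← hce] at hyn2
    have hdiff : (g⁻¹ * x ^ m * g * (y ^ n)⁻¹).1 ∈ levelFixer p k := by
      refine (mk_eq_one_iff _).1 ?_
      change QuotientGroup.mk' (levelStab E.group k) _ = 1
      rw [map_mul, map_inv, h, mul_inv_cancel]
    -- It agrees with `y ^ n ∈ St(2)` modulo `St(k) ≤ St(2)`.
    have hconj2 : g.1⁻¹ * x.1 ^ m * g.1 ∈ levelFixer p 2 := by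
      have := mul_mem (levelFixer_antitone (by omega : 2 ≤ k) hdiff) hyn2
      simpa using this
    have hx2 : x.1 ^ m ∈ levelFixer p 2 := by
      have := (levelFixer_normal 2).conj_mem _ hconj2 g.1
      simpa [mul_assoc] using this
    rw [zpow_eq_one_of_prime_dvd hxp (E.dvd_of_mem_generators hx hx2), map_one]

/-! ### The quotient of level two -/

/-- `g` acts on the second level by a shift of the first letter and, depending on the first letter,
a shift of the second one. -/
def ShiftsSecondLevel (g : TreeAut p) (m : ZMod p) (n : ZMod p → ZMod p) : Prop :=
  ∀ x y : ZMod p, g.1 [x, y] = [x + m, y + n x]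

theorem ShiftsSecondLevel.mul {g h : TreeAut p} {m m' : ZMod p} {n n' : ZMod p → ZMod p}
    (hg : ShiftsSecondLevel g m n) (hh : ShiftsSecondLevel h m' n') :
    ShiftsSecondLevel (g * h) (m + m') (fun x => n' x + n (x + m')) := fun x y => by
  rw [mul_apply, hh, hg, add_assoc, add_assoc, add_comm m']

theorem ShiftsSecondLevel.inv {g : TreeAut p} {m : ZMod p} {n : ZMod p → ZMod p}
    (hg : ShiftsSecondLevel g m n) : ShiftsSecondLevel g⁻¹ (-m) (fun x => -n (x - m)) :=
  fun x y => by
    rw [inv_apply_eq_iff, hg, ← sub_eq_add_neg, sub_add_cancel, neg_add_cancel_right]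

theorem ShiftsSecondLevel.exists_pow {g : TreeAut p} {m : ZMod p} {n : ZMod p → ZMod p}
    (hg : ShiftsSecondLevel g m n) (j : ℕ) : ∃ n', ShiftsSecondLevel (g ^ j) (j * m) n' := by
  induction j with
  | zero => exact ⟨0, fun x y => by simp⟩
  | succ j ih =>
    obtain ⟨n', hn'⟩ := ih
    have h := hn'.mul hg
    rw [← pow_succ, show (j : ZMod p) * m + m = (j + 1 : ℕ) * m by push_cast; ring] at h
    exact ⟨_, h⟩

theorem ShiftsSecondLevel.pow_of_zero {g : TreeAut p} {n : ZMod p → ZMod p}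
    (hg : ShiftsSecondLevel g 0 n) (j : ℕ) : ShiftsSecondLevel (g ^ j) 0 (fun x => j * n x) := by
  induction j with
  | zero => intro x y; simp
  | succ j ih =>
    rw [pow_succ]
    convert ih.mul hg using 1
    · simp
    · funext x
      push_cast
      rw [add_zero]
      ring

theorem ShiftsSecondLevel.mem_levelFixer {g : TreeAut p} (hg : ShiftsSecondLevel g 0 0) :
    g ∈ levelFixer p 2 := fun w hw => by
  obtain ⟨x, y, rfl⟩ := List.length_eq_two.1 hw
  simpa using hg x y

theorem shiftsSecondLevel_rooted (m : ZMod p) : ShiftsSecondLevel (rooted m) m 0 := fun x y => by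
  rw [rooted_apply_cons, Pi.zero_apply, add_zero]

theorem shiftsSecondLevel_directed (c : ZMod p) (e : Vec p) :
    ShiftsSecondLevel (directed c e) 0 (fun x => extendZero e (x - c)) := fun x y => by
  rw [directed_apply_pair, add_zero]

/-- On the second level `G` acts through the wreath product of two cyclic groups of order `p`. -/
theorem Datum.exists_shiftsSecondLevel (E : Datum p) {g : TreeAut p} (hg : g ∈ E.group) :
    ∃ m n, ShiftsSecondLevel g m n := by
  induction hg using Subgroup.closure_induction with
  | mem x hx =>
    rcases hx with rfl | ⟨j, i, rfl⟩
    · exact ⟨_, _, shiftsSecondLevel_rooted 1⟩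
    · exact ⟨_, _, shiftsSecondLevel_directed _ _⟩
  | one => exact ⟨0, 0, fun x y => by simp⟩
  | mul x y _ _ hx hy =>
    obtain ⟨_, _, hx⟩ := hx
    obtain ⟨_, _, hy⟩ := hy
    exact ⟨_, _, hx.mul hy⟩
  | inv x _ hx =>
    obtain ⟨_, _, hx⟩ := hx
    exact ⟨_, _, hx.inv⟩

/-- One `p`-th power kills the shift of the first letter, a second one the shifts below it. -/
theorem Datum.isPGroup_quotient_two (E : Datum p) : IsPGroup p (E.group ⧸ levelStab E.group 2) := by
  intro q
  obtain ⟨g, rfl⟩ := QuotientGroup.mk'_surjective (levelStab E.group 2) q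
  obtain ⟨m, n, hg⟩ := E.exists_shiftsSecondLevel g.2
  obtain ⟨n', hn'⟩ := hg.exists_pow p
  rw [ZMod.natCast_self, zero_mul] at hn'
  have h := hn'.pow_of_zero p
  refine ⟨2, ?_⟩
  rw [← map_pow, sq, pow_mul]
  refine (mk_eq_one_iff ((g ^ p) ^ p)).2 (ShiftsSecondLevel.mem_levelFixer ?_)
  rw [show (fun x => (p : ZMod p) * n' x) = 0 by funext x; simp] at h
  exact h

/-- Up to the second level, a directed automorphism whose defining vector is a multiple of that of a
second one is a conjugate by a rooted automorphism of a power of the second one. -/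
theorem directed_smul_mul_inv_mem_levelFixer_two (c c' : ZMod p) (e : Vec p) (l : ZMod p) :
    directed c' (l • e) * (a ^ (c' - c).val * directed c e ^ l.val * (a ^ (c' - c).val)⁻¹)⁻¹ ∈
      levelFixer p 2 := by
  have hr := shiftsSecondLevel_rooted (c' - c)
  have hd := shiftsSecondLevel_directed c' (l • e)
  have hd' := (shiftsSecondLevel_directed c e).pow_of_zero l.val
  rw [a_pow, ZMod.natCast_zmod_val]
  refine ShiftsSecondLevel.mem_levelFixer ?_
  convert hd.mul ((hr.mul hd').mul hr.inv).inv using 1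
  · ring
  · funext x
    simp only [ZMod.natCast_zmod_val, extendZero_smul, Pi.zero_apply]
    ring_nf

theorem Datum.exists_smul_of_dim_le_one (E : Datum p) (hE : E.dim ≤ 1) (j₀ : ZMod p)
    (i₀ : Fin (E.num j₀)) (j : ZMod p) (i : Fin (E.num j)) :
    ∃ l : ZMod p, E.vec j i = l • E.vec j₀ i₀ := by
  let W := Submodule.span (ZMod p)
    {v : Vec p | ∃ (j : ZMod p) (i : Fin (E.num j)), v = E.vec j i}
  have hmem : ∀ (j : ZMod p) (i : Fin (E.num j)), E.vec j i ∈ W := fun j i =>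
    Submodule.subset_span ⟨j, i, rfl⟩
  have hne : (⟨E.vec j₀ i₀, hmem j₀ i₀⟩ : W) ≠ 0 := fun h =>
    E.vec_ne_zero j₀ i₀ (congrArg Subtype.val h)
  have hpos : 0 < Module.finrank (ZMod p) W := Module.finrank_pos_iff_exists_ne_zero.2 ⟨_, hne⟩
  have hdim : Module.finrank (ZMod p) W = 1 := le_antisymm hE hpos
  obtain ⟨l, hl⟩ := (finrank_eq_one_iff_of_nonzero' _ hne).1 hdim ⟨E.vec j i, hmem j i⟩
  exact ⟨l, (congrArg Subtype.val hl).symm⟩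

theorem Datum.one_le_dim (E : Datum p) : 1 ≤ E.dim := by
  obtain ⟨j₀, hj₀⟩ := E.exists_num_ne_zero
  let i₀ : Fin (E.num j₀) := ⟨0, Nat.pos_of_ne_zero hj₀⟩
  refine Module.finrank_pos_iff_exists_ne_zero.2
    ⟨⟨E.vec j₀ i₀, Submodule.subset_span ⟨j₀, i₀, rfl⟩⟩, fun h => ?_⟩
  exact E.vec_ne_zero j₀ i₀ (congrArg Subtype.val h)

/-- All defining vectors are multiples of a single one, so modulo `St(2)` every directed generator
is conjugate under `⟨a⟩` to a power of one `b`. -/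
theorem Datum.admitsRamificationStructure_two (hp : p ≠ 2) (E : Datum p) (hE : E.dim ≤ 1) :
    AdmitsRamificationStructure (E.group ⧸ levelStab E.group 2) := by
  obtain ⟨j₀, hj₀⟩ := E.exists_num_ne_zero
  let i₀ : Fin (E.num j₀) := ⟨0, Nat.pos_of_ne_zero hj₀⟩
  let π := QuotientGroup.mk' (levelStab E.group 2)
  let a' : E.group := ⟨a, E.a_mem⟩
  let b' : E.group := ⟨b j₀ (E.vec j₀ i₀), E.b_mem j₀ i₀⟩
  have hb' : b' ^ p = 1 := Subtype.ext (directed_pow_prime _ _)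
  have ha' : a' ^ p = 1 := Subtype.ext a_pow_prime
  have hker : ∀ g : E.group, π g = 1 ↔ g.1 ∈ levelFixer p 2 := fun g => mk_eq_one_iff g
  -- The first level sees only the exponent of `a`; this is what excludes both inclusions between
  -- `⟨a⟩` and `⟨b⟩` below.
  have hshift : ∀ s t : ℤ, π (a' ^ s * b' ^ t) = 1 → (p : ℤ) ∣ s := fun s t h => by
    have h1 := levelFixer_antitone one_le_two ((hker _).1 h)
    have h2 : ShiftsFirstLevel ((rooted 1) ^ s * (b j₀ (E.vec j₀ i₀)) ^ t) (s : ZMod p) := by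
      simpa [b] using ((shiftsFirstLevel_rooted (1 : ZMod p)).zpow s).mul
        ((shiftsFirstLevel_directed (1 - j₀) (E.vec j₀ i₀)).zpow t)
    exact (ZMod.intCast_zmod_eq_zero_iff_dvd s p).1 (h2.mem_levelFixer_one_iff.1 h1)
  have hprime : Prime (p : ℤ) := Nat.prime_iff_prime_int.1 Fact.out
  refine admitsRamificationStructure_of_isPGroup hp E.isPGroup_quotient_two
    (α := π a') (β := π b') (by rw [← map_pow, ha', map_one]) (by rw [← map_pow, hb', map_one])
    (top_le_iff.1 ?_) ?_ ?_
  · have hgen : Subgroup.closure (imageInQuotient E.group 2 E.generators) = ⊤ :=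
      closure_imageInQuotient E.generators 2
    refine hgen.ge.trans ((Subgroup.closure_le _).2 ?_)
    have hα : π a' ∈ Subgroup.closure {π a', π b'} := Subgroup.subset_closure (by simp)
    have hβ : π b' ∈ Subgroup.closure {π a', π b'} := Subgroup.subset_closure (by simp)
    rintro _ ⟨g, hg, rfl⟩
    rcases hg with hg | ⟨j, i, hg⟩
    · have : g = a' := Subtype.ext hg
      rw [this]
      exact hα
    · obtain ⟨l, hl⟩ := E.exists_smul_of_dim_le_one hE j₀ i₀ j i
      rw [hl] at hg
      have h := directed_smul_mul_inv_mem_levelFixer_two (1 - j₀) (1 - j) (E.vec j₀ i₀) l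
      set s := ((1 - j) - (1 - j₀)).val
      have hπ : π (g * (a' ^ s * b' ^ l.val * (a' ^ s)⁻¹)⁻¹) = 1 := by
        rw [hker]
        change g.1 * _ ∈ _
        rw [hg]
        exact h
      rw [map_mul, map_inv, mul_inv_eq_one] at hπ
      change π g ∈ _
      rw [hπ, map_mul, map_mul, map_inv, map_pow, map_pow]
      exact mul_mem (mul_mem (pow_mem hα _) (pow_mem hβ _)) (inv_mem (pow_mem hα _))
  · rintro ⟨n, hn⟩
    have hn' : π a' ^ n = π b' := hn
    have hd := hshift n (-1) (by rw [map_mul, map_zpow, hn', zpow_neg_one, map_inv, mul_inv_cancel])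
    rw [← map_zpow, zpow_eq_one_of_prime_dvd ha' hd, map_one] at hn'
    exact directed_not_mem_levelFixer (E.vec_ne_zero j₀ i₀) le_rfl ((hker b').1 hn'.symm)
  · rintro ⟨n, hn⟩
    have hn' : π b' ^ n = π a' := hn
    exact hprime.not_dvd_one (hshift 1 (-n) (by
      rw [map_mul, zpow_one, map_zpow, zpow_neg, hn', mul_inv_cancel]))

end Quotients

end MultiEGS

theorem theorem1p1 (p : ℕ) [Fact p.Prime] (hp : p ≠ 2) (E : MultiEGS.Datum p)
    (hE : ∀ e : MultiEGS.Vec p, e ≠ 0 → E.group ≠ MultiEGS.ggsGroup e) :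
    (MultiEGS.RegularBranchOver E.group ⁅E.group, E.group⁆ →
      ∀ k : ℕ, E.dim + 1 ≤ k →
        MultiEGS.AdmitsRamificationStructure (E.group ⧸ MultiEGS.levelStab E.group k)) ∧
    ((∀ g ∈ E.group, IsOfFinOrder g) → ¬ MultiEGS.RegularBranchOver E.group ⁅E.group, E.group⁆ →
      ∀ k : ℕ, 4 ≤ k →
        MultiEGS.AdmitsRamificationStructure (E.group ⧸ MultiEGS.levelStab E.group k)) ∧
    (¬ (∀ g ∈ E.group, IsOfFinOrder g) → ¬ MultiEGS.RegularBranchOver E.group ⁅E.group, E.group⁆ →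
      ∀ k : ℕ, 3 ≤ k →
        MultiEGS.AdmitsRamificationStructure (E.group ⧸ MultiEGS.levelStab E.group k)) := by
  refine ⟨fun _ k hk => ?_, fun _ _ k hk => ?_, fun _ _ k hk => ?_⟩
  · have h1 := E.one_le_dim
    -- Since `r ≥ 1`, the only level below three is `k = 2`, and it forces `r = 1`.
    rcases lt_or_ge k 3 with h3 | h3
    · obtain rfl : k = 2 := by omega
      exact E.admitsRamificationStructure_two hp (by omega)
    · exact E.admitsRamificationStructure_of_three_le hp h3
  · exact E.admitsRamificationStructure_of_three_le hp (by omega)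
  · exact E.admitsRamificationStructure_of_three_le hp hk
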